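/- Let $d_1 \ge 2$ and $d_2 \ge 1$ be integers with $\frac{1}{d_1}+\frac{1}{2d_2}\notin\mathbb{N}$. Consider the double zeta-function $$\zeta_{2,(d_1,2d_2),(1,1)}(s_1,s_2)=\sum_{m_1,m_2\ge 1}\frac{1}{(m_1^{d_1})^{s_1}\,(m_1^{d_1}+m_2^{2d_2})^{s_2}},$$ which converges absolutely for $\Re(s_2)>\frac{1}{2d_2}$, $\Re(s_1+s_2)>\frac{1}{d_1}+\frac{1}{2d_2}$ and has a meromorphic continuation to $\mathbb{C}^2$, denoted by the same symbol. Then for every integer $N\ge 0$ the point $(1+N,-N)$ is a regular point of this meromorphic function, and the Riemann zeta-function satisfies $$\zeta(d_1)=-2\,\zeta_{2,(d_1,2d_2),(1,1)}(1+N,-N).$$ -/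

import Mathlib

open Filter Topology

/-- A product of holomorphic germs vanishes only if one of the factors does. -/
theorem eventually_zero_of_mul {n : ℕ} {h f : (Fin n → ℂ) → ℂ} {p : Fin n → ℂ}
    (hh : AnalyticAt ℂ h p) (hf : AnalyticAt ℂ f p) (hne : ¬ ∀ᶠ z in 𝓝 p, h z = 0)
    (hz : ∀ᶠ z in 𝓝 p, h z ≠ 0 → f z = 0) : ∀ᶠ z in 𝓝 p, f z = 0 := by
  obtain ⟨r, hr, hb⟩ := Metric.eventually_nhds_iff_ball.1
    (hh.eventually_analyticAt.and (hf.eventually_analyticAt.and hz))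
  have hball : ∀ᶠ z in 𝓝 p, z ∈ Metric.ball p r := Metric.ball_mem_nhds p hr
  obtain ⟨q, hq0, hq⟩ := ((not_eventually.1 hne).and_eventually hball).exists
  have hev : f =ᶠ[𝓝 q] 0 := by
    filter_upwards [(hb q hq).1.continuousAt.eventually_ne hq0,
      Metric.isOpen_ball.mem_nhds hq] with z hz1 hz2
    exact (hb z hz2).2.2 hz1
  have hEq := AnalyticOnNhd.eqOn_zero_of_preconnected_of_eventuallyEq_zero (𝕜 := ℂ)
    (fun z hz' => (hb z hz').2.1) (convex_ball p r).isPreconnected hq hev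
  filter_upwards [hball] with z hz' using hEq hz'

/-- A set of points near `p` is thin if it is contained in the zero set of a holomorphic germ at `p`
that is not the zero germ. `EqOffThin F G p` says that `F` and `G` agree near `p` outside a thin
set. -/
def EqOffThin {n : ℕ} (F G : (Fin n → ℂ) → ℂ) (p : Fin n → ℂ) : Prop :=
  ∃ h : (Fin n → ℂ) → ℂ, AnalyticAt ℂ h p ∧ (¬ ∀ᶠ z in 𝓝 p, h z = 0) ∧
    ∀ᶠ z in 𝓝 p, h z ≠ 0 → F z = G z

/-- `F` is meromorphic at `p ∈ ℂⁿ`: near `p` it is a quotient `g / h` of holomorphic functions,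
`h` not identically zero near `p` (the values of `F` on the zero set of `h` are irrelevant). -/
def IsMeromorphicAt {n : ℕ} (F : (Fin n → ℂ) → ℂ) (p : Fin n → ℂ) : Prop :=
  ∃ g h : (Fin n → ℂ) → ℂ, AnalyticAt ℂ g p ∧ AnalyticAt ℂ h p ∧ (¬ ∀ᶠ z in 𝓝 p, h z = 0) ∧
    ∀ᶠ z in 𝓝 p, h z ≠ 0 → F z = g z / h z

/-- `p` is a regular point of the meromorphic function `F`: the germ of `F` at `p` is that of a
function holomorphic at `p`. -/
def IsRegularPoint {n : ℕ} (F : (Fin n → ℂ) → ℂ) (p : Fin n → ℂ) : Prop :=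
  ∃ φ : (Fin n → ℂ) → ℂ, AnalyticAt ℂ φ p ∧ EqOffThin F φ p

open Classical in
/-- The value of the meromorphic function `F` at a regular point `p`, that is, the value at `p` of
the function holomorphic at `p` that represents the germ of `F` (`0` if `p` is not regular). -/
noncomputable def regularValue {n : ℕ} (F : (Fin n → ℂ) → ℂ) (p : Fin n → ℂ) : ℂ :=
  if h : IsRegularPoint F p then h.choose p else 0

/-- The value at a regular point does not depend on the holomorphic representative. -/
theorem regularValue_eq {n : ℕ} {F φ : (Fin n → ℂ) → ℂ} {p : Fin n → ℂ}
    (hφ : AnalyticAt ℂ φ p) (hF : EqOffThin F φ p) : regularValue F p = φ p := by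
  have hreg : IsRegularPoint F p := ⟨φ, hφ, hF⟩
  obtain ⟨hψ, k, hk, hk0, hkF⟩ := hreg.choose_spec
  obtain ⟨h, hh, hh0, hhF⟩ := hF
  rw [regularValue, dif_pos hreg]
  set ψ := hreg.choose
  have h1 : ∀ᶠ z in 𝓝 p, (k * (ψ - φ)) z = 0 := by
    refine eventually_zero_of_mul hh (hk.mul (hψ.sub hφ)) hh0 ?_
    filter_upwards [hkF, hhF] with z h1 h2 h3
    by_cases h4 : k z = 0
    · simp [h4]
    · simp [← h1 h4, ← h2 h3]
  have h2 : ∀ᶠ z in 𝓝 p, (ψ - φ) z = 0 := by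
    refine eventually_zero_of_mul hk (hψ.sub hφ) hk0 ?_
    filter_upwards [h1] with z h3 h4
    exact (mul_eq_zero.1 h3).resolve_left h4
  exact sub_eq_zero.1 h2.self_of_nhds

/-- The general term `∏ⱼ (γ₁ m₁^d₁ + ⋯ + γⱼ mⱼ^dⱼ)^(-sⱼ)` of the multiple zeta series. -/
noncomputable def multiZetaTerm {n : ℕ} (d : Fin n → ℕ) (γ : Fin n → ℂ) (s : Fin n → ℂ)
    (m : Fin n → ℕ+) : ℂ :=
  ∏ j : Fin n, (∑ i ∈ Finset.Iic j, γ i * ((m i : ℕ) : ℂ) ^ d i) ^ (-(s j))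

/-- The domain `Re (sⱼ + ⋯ + sₙ) > 1/dⱼ + ⋯ + 1/dₙ` (`1 ≤ j ≤ n`) of absolute convergence. -/
def multiZetaDomain {n : ℕ} (d : Fin n → ℕ) : Set (Fin n → ℂ) :=
  {s | ∀ j : Fin n, ∑ i ∈ Finset.Ici j, (1 / (d i : ℝ)) < (∑ i ∈ Finset.Ici j, s i).re}

/-- `F` is the meromorphic continuation to `ℂⁿ` of the multiple zeta series
`∑_{m₁, …, mₙ ≥ 1} ∏ⱼ (γ₁ m₁^d₁ + ⋯ + γⱼ mⱼ^dⱼ)^(-sⱼ)`: it is meromorphic on `ℂⁿ`, and on the domain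
of convergence the series converges (absolutely) with sum `F s`. -/
structure IsMultiZetaContinuation {n : ℕ} (d : Fin n → ℕ) (γ : Fin n → ℂ)
    (F : (Fin n → ℂ) → ℂ) : Prop where
  meromorphic : ∀ p : Fin n → ℂ, IsMeromorphicAt F p
  hasSum : ∀ s ∈ multiZetaDomain d, HasSum (multiZetaTerm d γ s) (F s)

/-! Write `a = d₁` and `b = 2 * d₂`. Since `b` is even, `exp (-x ^ b)` is a Schwartz function on the
whole line, and Poisson summation shows that `∑_{n ≥ 1} exp (-t n^b)` equals `Γ(1/b + 1) t^(-1/b) -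
1/2` up to an error `O(t^K)` for every `K`: the expansion at `0` has no further terms
(`abs_powThetaRem_le`).

Multiplying by `exp (-x t)` and taking Mellin transforms expresses `∑_n (x + n^b)^(-s)` as `Γ(s)⁻¹
(Γ(1/b + 1) Γ(s - 1/b) x^(1/b - s) + R(x, s)) - x^(-s) / 2`, where `R` is entire in `s` and decays
in `x` faster than any power (`hasSum_nat_pow_add_cpow`, `norm_powThetaMellin_le`). Setting `x =
m^a` and summing against `m^(-a s₀)` gives an explicit continuation `doubleZeta`, built from `Γ`,
`ζ` and an entire remainder.

At `s₁ = -N` the factor `1 / Γ(s₁)` vanishes and everything multiplying it is finite, so only `-ζ(a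
(s₀ + s₁)) / 2 = -ζ(a) / 2` survives. The excluded case `1/a + 1/b = 1` is exactly the one where the
pole of `ζ(a (s₀ + s₁ - 1/b))` passes through the point. The identity theorem for meromorphic
functions on `ℂⁿ` (`eqOffThin_of_eventuallyEq`) transfers the result to any continuation. -/

/-! ### The Schwartz function `exp (-x ^ b)` and its Fourier transform. -/

theorem pow_mul_exp_neg_pow_le {b : ℕ} (hb : Even b) (hb0 : b ≠ 0) (k : ℕ) (x : ℝ) :
    |x| ^ k * Real.exp (-x ^ b) ≤ Real.exp 1 * (k.factorial : ℝ) := by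
  -- This reduces the decay to that of `exp (1 - |x|)`, which the exponential series controls.
  have h1 : |x| - 1 ≤ x ^ b := by
    rw [← hb.pow_abs x]
    rcases le_total 1 |x| with h | h
    · have := le_self_pow₀ h hb0
      linarith
    · have := pow_nonneg (abs_nonneg x) b
      linarith
  have h2 : Real.exp (-x ^ b) ≤ Real.exp 1 * (Real.exp |x|)⁻¹ := by
    rw [← Real.exp_neg, ← Real.exp_add]
    exact Real.exp_le_exp.2 (by linarith)
  have h3 := Real.pow_div_factorial_le_exp |x| (abs_nonneg x) k
  have hk : (0 : ℝ) < k.factorial := by positivity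
  rw [div_le_iff₀ hk] at h3
  calc |x| ^ k * Real.exp (-x ^ b)
      ≤ (Real.exp |x| * k.factorial) * (Real.exp 1 * (Real.exp |x|)⁻¹) := by gcongr
    _ = Real.exp 1 * (k.factorial : ℝ) := by
      field_simp

theorem exists_bound_poly_mul_exp_neg_pow {b : ℕ} (hb : Even b) (hb0 : b ≠ 0) (k : ℕ)
    (P : Polynomial ℂ) :
    ∃ C : ℝ, ∀ x : ℝ, |x| ^ k * ‖P.eval (x : ℂ) * Complex.exp (-(x : ℂ) ^ b)‖ ≤ C := by
  induction P using Polynomial.induction_on' with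
  | add P Q hP hQ =>
    obtain ⟨C, hC⟩ := hP
    obtain ⟨D, hD⟩ := hQ
    refine ⟨C + D, fun x => (?_ : _ ≤ _).trans (add_le_add (hC x) (hD x))⟩
    rw [Polynomial.eval_add, add_mul, ← mul_add]
    gcongr
    exact norm_add_le _ _
  | monomial n c =>
    refine ⟨‖c‖ * (Real.exp 1 * ((k + n).factorial : ℝ)), fun x => ?_⟩
    have h := pow_mul_exp_neg_pow_le hb hb0 (k + n) x
    have h1 : ‖Complex.exp (-(x : ℂ) ^ b)‖ = Real.exp (-x ^ b) := by
      rw [Complex.norm_exp]; norm_cast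
    rw [Polynomial.eval_monomial, norm_mul, norm_mul, norm_pow, h1, Complex.norm_real,
      Real.norm_eq_abs]
    calc |x| ^ k * (‖c‖ * |x| ^ n * Real.exp (-x ^ b))
        = ‖c‖ * (|x| ^ (k + n) * Real.exp (-x ^ b)) := by ring
      _ ≤ _ := by gcongr

theorem contDiff_exp_neg_pow (b : ℕ) :
    ContDiff ℝ (⊤ : ℕ∞) (fun x : ℝ => Complex.exp (-(x : ℂ) ^ b)) := by
  have : ContDiff ℝ (⊤ : ℕ∞) (fun x : ℝ => (x : ℂ)) := Complex.ofRealCLM.contDiff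
  fun_prop

theorem iteratedDeriv_exp_neg_pow (b n : ℕ) :
    ∃ P : Polynomial ℂ, iteratedDeriv n (fun x : ℝ => Complex.exp (-(x : ℂ) ^ b)) =
      fun x : ℝ => P.eval (x : ℂ) * Complex.exp (-(x : ℂ) ^ b) := by
  induction n with
  | zero => exact ⟨1, by simp⟩
  | succ n ih =>
    obtain ⟨P, hP⟩ := ih
    refine ⟨P.derivative - P * Polynomial.C (b : ℂ) * Polynomial.X ^ (b - 1), ?_⟩
    rw [iteratedDeriv_succ, hP]
    funext x
    have h1 : HasDerivAt (fun z : ℂ => P.eval z * Complex.exp (-z ^ b)) _ (x : ℂ) :=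
      (P.hasDerivAt (x : ℂ)).mul ((hasDerivAt_pow b (x : ℂ)).neg.cexp)
    rw [h1.comp_ofReal.deriv]
    simp only [Polynomial.eval_sub, Polynomial.eval_mul, Polynomial.eval_C, Polynomial.eval_pow,
      Polynomial.eval_X, Pi.neg_apply]
    ring

/-- The Schwartz function `x ↦ exp (-x ^ b)` for a positive even exponent `b`. -/
noncomputable def expNegPow (b : ℕ) (hb : Even b) (hb0 : b ≠ 0) : SchwartzMap ℝ ℂ where
  toFun x := Complex.exp (-(x : ℂ) ^ b)
  smooth' := contDiff_exp_neg_pow b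
  decay' k n := by
    obtain ⟨P, hP⟩ := iteratedDeriv_exp_neg_pow b n
    obtain ⟨C, hC⟩ := exists_bound_poly_mul_exp_neg_pow hb hb0 k P
    refine ⟨C, fun x => ?_⟩
    rw [norm_iteratedFDeriv_eq_norm_iteratedDeriv, hP]
    exact hC x

open MeasureTheory FourierTransform in
theorem fourier_comp_mul_right (f : ℝ → ℂ) {h : ℝ} (hh : 0 < h) (y : ℝ) :
    𝓕 (fun x => f (x * h)) y = (h⁻¹ : ℂ) * 𝓕 f (y / h) := by
  rw [Real.fourier_eq, Real.fourier_eq]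
  have := Measure.integral_comp_mul_right
    (fun v : ℝ => Real.fourierChar (-(inner ℝ v (y / h))) • f v) h
  rw [abs_of_pos (inv_pos.2 hh), Complex.real_smul, Complex.ofReal_inv] at this
  rw [← this]
  congr 1
  funext v
  simp only [RCLike.inner_apply, conj_trivial]
  congr 3
  field_simp

theorem fourier_expNegPow_zero {b : ℕ} (hb : Even b) (hb0 : b ≠ 0) :
    FourierTransform.fourier (expNegPow b hb hb0 : ℝ → ℂ) 0 = 2 * (Real.Gamma (1 / b + 1) : ℂ) := by
  rw [Real.fourier_eq]
  have hb0' : (0 : ℝ) < b := by positivity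
  have h1 : ∀ v : ℝ, Real.fourierChar (-(inner ℝ v (0 : ℝ))) • expNegPow b hb hb0 v =
      ((Real.exp (-|v| ^ b) : ℝ) : ℂ) := by
    intro v
    simp only [inner_zero_right, neg_zero, AddChar.map_zero_eq_one, one_smul]
    change Complex.exp (-(v : ℂ) ^ b) = _
    rw [hb.pow_abs]
    push_cast
    rfl
  simp_rw [h1]
  rw [integral_complex_ofReal, integral_comp_abs (f := fun v : ℝ => Real.exp (-v ^ b)),
    ← integral_exp_neg_rpow hb0']
  simp

/-! ### The theta series and its expansion at `0`. -/

theorem summable_exp_neg_mul_pow {b : ℕ} (hb0 : b ≠ 0) {t : ℝ} (ht : 0 < t) :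
    Summable fun n : ℕ+ => Real.exp (-t * (n : ℝ) ^ b) := by
  have h1 : Summable fun n : ℕ => Real.exp (n * -t) := by
    exact Real.summable_exp_nat_mul_iff.2 (by linarith)
  refine (h1.comp_injective PNat.coe_injective).of_nonneg_of_le (fun n => by positivity) fun n => ?_
  refine Real.exp_le_exp.2 ?_
  have : (n : ℝ) ≤ (n : ℝ) ^ b := le_self_pow₀ (by exact_mod_cast (one_le : (1 : ℕ+) ≤ n)) hb0
  nlinarith

/-- The theta series `∑_{n ≥ 1} exp (-t n^b)`. -/
noncomputable def powTheta (b : ℕ) (t : ℝ) : ℝ := ∑' n : ℕ+, Real.exp (-t * (n : ℝ) ^ b)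

/-- The theta series minus its asymptotic expansion at `0`. -/
noncomputable def powThetaRem (b : ℕ) (t : ℝ) : ℝ :=
  powTheta b t - Real.Gamma (1 / b + 1) * t ^ (-(1 / b : ℝ)) + 1 / 2

theorem tsum_int_expNegPow {b : ℕ} (hb : Even b) (hb0 : b ≠ 0) {h : ℝ} (hh : 0 < h) :
    ∑' n : ℤ, expNegPow b hb hb0 (n * h) = 1 + 2 * (powTheta b (h ^ b) : ℂ) := by
  have h0 : ∀ n : ℤ, expNegPow b hb hb0 (n * h) = ((Real.exp (-h ^ b * (n : ℝ) ^ b) : ℝ) : ℂ) := by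
    intro n
    change Complex.exp _ = _
    push_cast
    ring_nf
  have hs : Summable fun n : ℤ => Real.exp (-h ^ b * (n : ℝ) ^ b) := by
    have h1 : Summable fun n : ℕ => Real.exp (-h ^ b * (n : ℝ) ^ b) :=
      (summable_pnat_iff_summable_nat (f := fun n : ℕ => Real.exp (-h ^ b * (n : ℝ) ^ b))).1
        (summable_exp_neg_mul_pow hb0 (by positivity))
    refine Summable.of_nat_of_neg (by simpa using h1) ?_
    simpa [hb.neg_pow] using h1
  simp_rw [h0]
  rw [← Complex.ofReal_tsum, tsum_int_eq_zero_add_two_mul_tsum_pnat ?_ hs]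
  · simp [powTheta, hb0]
  · intro n
    simp [hb.neg_pow]

/-- Poisson summation for `x ↦ exp (-(x h) ^ b)`: the frequency `0` gives the main term `2 Γ(1/b +
1) / h`, and rapid decay of the Fourier transform bounds frequency `n ≠ 0` by a multiple of `h^(k-1)
/ |n|^k`. The constant `1/2` comes from the term `n = 0` on the other side. -/
theorem abs_powThetaRem_pow_le {b : ℕ} (hb : Even b) (hb0 : b ≠ 0) {k : ℕ} (hk : 2 ≤ k) :
    ∃ C : ℝ, ∀ h : ℝ, 0 < h → |powThetaRem b (h ^ b)| ≤ C * h ^ (k - 1) := by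
  set g := expNegPow b hb hb0 with hg
  obtain ⟨C, -, hC⟩ := (FourierTransform.fourier g).decay k 0
  have hsum : Summable fun n : ℤ => 1 / |(n : ℝ)| ^ k := by
    have := (Real.summable_one_div_int_pow (p := k)).2 (by omega)
    simpa [abs_pow] using this.abs
  refine ⟨2⁻¹ * (C * ∑' n : ℤ, 1 / |(n : ℝ)| ^ k), fun h hh => ?_⟩
  have hP := (SchwartzMap.compCLMOfContinuousLinearEquiv ℂ
    (ContinuousLinearEquiv.unitsEquivAut ℝ (Units.mk0 h hh.ne')) g).tsum_eq_tsum_fourier 0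
  have e1 : ∀ n : ℤ, SchwartzMap.compCLMOfContinuousLinearEquiv ℂ
      (ContinuousLinearEquiv.unitsEquivAut ℝ (Units.mk0 h hh.ne')) g (0 + n) = g (n * h) := by
    intro n; simp
  have e2 : ∀ n : ℤ, FourierTransform.fourier (SchwartzMap.compCLMOfContinuousLinearEquiv ℂ
      (ContinuousLinearEquiv.unitsEquivAut ℝ (Units.mk0 h hh.ne')) g) (n : ℝ) =
      (h⁻¹ : ℂ) * FourierTransform.fourier (g : ℝ → ℂ) (n / h) := by
    intro n
    rw [← fourier_comp_mul_right _ hh]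
    rfl
  have e3 : ∑' n : ℤ, (h⁻¹ : ℂ) * FourierTransform.fourier (g : ℝ → ℂ) (n / h) =
      1 + 2 * (powTheta b (h ^ b) : ℂ) := by
    rw [← tsum_int_expNegPow hb hb0 hh, ← hg, ← tsum_congr e1]
    refine Eq.trans ?_ hP.symm
    refine tsum_congr fun n => ?_
    rw [← e2]
    simp
  have hbd : ∀ n : ℤ, ‖FourierTransform.fourier (g : ℝ → ℂ) (n / h)‖ * |(n : ℝ)| ^ k ≤
      C * h ^ k := by
    intro n
    have := hC (n / h)
    rw [norm_iteratedFDeriv_zero, Real.norm_eq_abs, abs_div, abs_of_pos hh, div_pow,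
      div_mul_eq_mul_div, div_le_iff₀ (by positivity), mul_comm] at this
    exact this
  -- At `n = 0` both sides are zero, because `1 / 0 ^ k = 0` for `k ≠ 0`.
  have hbd' : ∀ n : ℤ, ‖if n = 0 then 0 else
      (h⁻¹ : ℂ) * FourierTransform.fourier (g : ℝ → ℂ) (n / h)‖ ≤
      C * h ^ (k - 1) * (1 / |(n : ℝ)| ^ k) := by
    intro n
    split_ifs with hn
    · simp [hn, show k ≠ 0 by omega]
    · have hn' : 0 < |(n : ℝ)| := by positivity
      rw [mul_one_div, le_div_iff₀ (by positivity), norm_mul, mul_assoc]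
      refine (mul_le_mul_of_nonneg_left (hbd n) (norm_nonneg _)).trans_eq ?_
      rw [norm_inv, Complex.norm_real, Real.norm_of_nonneg hh.le]
      obtain ⟨j, rfl⟩ : ∃ j, k = j + 1 := ⟨k - 1, by omega⟩
      simp only [Nat.add_sub_cancel]
      field_simp
      ring
  have hsum' := hsum.mul_left (C * h ^ (k - 1))
  have hS : Summable fun n : ℤ => (h⁻¹ : ℂ) * FourierTransform.fourier (g : ℝ → ℂ) (n / h) := by
    refine Summable.of_norm_bounded_eventually hsum' ?_
    filter_upwards [(Set.finite_singleton (0 : ℤ)).compl_mem_cofinite] with n hn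
    simpa [show n ≠ 0 from hn] using hbd' n
  rw [hS.tsum_eq_add_tsum_ite 0] at e3
  have hmain : (2 : ℂ) * (powThetaRem b (h ^ b) : ℂ) = ∑' n : ℤ, if n = 0 then 0 else
      (h⁻¹ : ℂ) * FourierTransform.fourier (g : ℝ → ℂ) (n / h) := by
    rw [Int.cast_zero, zero_div, fourier_expNegPow_zero] at e3
    have hpow : (h ^ b) ^ (-(1 / b : ℝ)) = h⁻¹ := by
      rw [← Real.rpow_natCast, ← Real.rpow_mul hh.le, ← Real.rpow_neg_one]
      congr 1
      field_simp
    rw [powThetaRem, hpow]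
    push_cast
    linear_combination -e3
  have hfin := tsum_of_norm_bounded hsum'.hasSum hbd'
  rw [← hmain, tsum_mul_left, norm_mul, Complex.norm_real, Real.norm_eq_abs] at hfin
  norm_num at hfin
  simp only [one_div] at hfin ⊢
  nlinarith

theorem abs_powThetaRem_le {b : ℕ} (hb : Even b) (hb0 : b ≠ 0) {K : ℕ} (hK : 1 ≤ K) :
    ∃ C : ℝ, ∀ t : ℝ, 0 < t → |powThetaRem b t| ≤ C * t ^ K := by
  have hb1 : 1 ≤ b := Nat.one_le_iff_ne_zero.2 hb0
  -- With `h = t^(1/b)` this exponent gives `h^(k-1) = h^(b K) = t^K`.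
  obtain ⟨C, hC⟩ := abs_powThetaRem_pow_le hb hb0 (k := b * K + 1) (by nlinarith)
  refine ⟨C, fun t ht => ?_⟩
  have h := hC (t ^ (1 / b : ℝ)) (by positivity)
  have e : (t ^ (1 / b : ℝ)) ^ b = t := by
    rw [one_div, Real.rpow_inv_natCast_pow ht.le hb0]
  rwa [Nat.add_sub_cancel, pow_mul, e] at h

theorem continuousOn_powThetaRem {b : ℕ} (hb0 : b ≠ 0) :
    ContinuousOn (powThetaRem b) (Set.Ioi 0) := by
  have h1 : ContinuousOn (powTheta b) (Set.Ioi 0) := by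
    refine continuousOn_of_forall_continuousAt fun t (ht : 0 < t) => ?_
    have : ContinuousOn (powTheta b) (Set.Ioi (t / 2)) := by
      refine continuousOn_tsum (fun n => by fun_prop)
        (summable_exp_neg_mul_pow hb0 (half_pos ht)) fun n u hu => ?_
      rw [Real.norm_of_nonneg (Real.exp_pos _).le]
      have hu' : t / 2 < u := hu
      gcongr
    exact this.continuousAt (Ioi_mem_nhds (by linarith))
  refine (h1.sub (continuousOn_const.mul ?_)).add continuousOn_const
  exact fun t ht => (Real.continuousAt_rpow_const t _ (Or.inl (ne_of_gt ht))).continuousWithinAt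

/-! ### Mellin transforms and the sum over `n`. -/

/-- The Mellin transform in `t` of `powThetaRem b t * exp (-x t)`. -/
noncomputable def powThetaMellin (b : ℕ) (x : ℝ) (s : ℂ) : ℂ :=
  mellin (fun t => ((powThetaRem b t * Real.exp (-x * t) : ℝ) : ℂ)) s

/-- One bound `C t^K exp (-x t)` serves both ends: near `0` it is `O(t^K)` with `K > -Re s`, and at
infinity half of the exponent absorbs `t^K`. Hence the Mellin transform converges for every `s` and
is entire. -/
theorem isBigO_powThetaRem_mul_exp {b : ℕ} (hb : Even b) (hb0 : b ≠ 0) {x : ℝ} (hx : 0 < x)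
    (s : ℂ) :
    ∃ K : ℕ, MeasureTheory.LocallyIntegrableOn
      (fun t => ((powThetaRem b t * Real.exp (-x * t) : ℝ) : ℂ)) (Set.Ioi 0) ∧
    ((fun t => ((powThetaRem b t * Real.exp (-x * t) : ℝ) : ℂ)) =O[atTop]
      fun t => Real.exp (-(x / 2) * t)) ∧
    ((fun t => ((powThetaRem b t * Real.exp (-x * t) : ℝ) : ℂ)) =O[𝓝[>] 0]
      (fun t : ℝ => t ^ (-(-(K : ℝ))))) ∧ -(K : ℝ) < s.re := by
  obtain ⟨K, hK⟩ := exists_nat_gt (max 1 (-s.re))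
  have hK1 : 1 ≤ K := by
    have := (le_max_left _ _).trans_lt hK
    exact_mod_cast this.le
  have hK2 := (le_max_right _ _).trans_lt hK
  obtain ⟨C, hC⟩ := abs_powThetaRem_le hb hb0 hK1
  have hbd : ∀ t : ℝ, 0 < t →
      ‖((powThetaRem b t * Real.exp (-x * t) : ℝ) : ℂ)‖ ≤ C * (t ^ K * Real.exp (-x * t)) := by
    intro t ht
    rw [Complex.norm_real, norm_mul, Real.norm_eq_abs, Real.norm_eq_abs, Real.abs_exp, ← mul_assoc]
    exact mul_le_mul_of_nonneg_right (hC t ht) (Real.exp_pos _).le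
  refine ⟨K, ?_, ?_, ?_, by linarith⟩
  · refine ContinuousOn.locallyIntegrableOn ?_ measurableSet_Ioi
    exact Complex.continuous_ofReal.comp_continuousOn
      ((continuousOn_powThetaRem hb0).mul (by fun_prop))
  · have h1 : (fun t => ((powThetaRem b t * Real.exp (-x * t) : ℝ) : ℂ)) =O[atTop]
        fun t => t ^ K * Real.exp (-x * t) := by
      refine Asymptotics.IsBigO.of_bound C ?_
      filter_upwards [eventually_gt_atTop 0] with t ht
      rw [Real.norm_of_nonneg (by positivity : 0 ≤ t ^ K * Real.exp (-x * t))]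
      exact hbd t ht
    refine h1.trans ?_
    have h2 := (isLittleO_pow_exp_pos_mul_atTop K (half_pos hx)).isBigO.mul
      (Asymptotics.isBigO_refl (fun t => Real.exp (-x * t)) atTop)
    refine h2.congr_right fun t => ?_
    rw [← Real.exp_add]
    ring_nf
  · refine Asymptotics.IsBigO.of_bound C ?_
    filter_upwards [self_mem_nhdsWithin] with t ht
    have ht' : 0 < t := ht
    rw [neg_neg, Real.rpow_natCast, norm_pow, Real.norm_of_nonneg ht'.le]
    refine (hbd t ht).trans ?_
    have hC0 : 0 ≤ C := by
      have := (abs_nonneg _).trans (hC 1 one_pos)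
      simpa using this
    have : Real.exp (-x * t) ≤ 1 := Real.exp_le_one_iff.2 (by nlinarith)
    gcongr
    exact mul_le_of_le_one_right (by positivity) this

theorem mellinConvergent_powThetaRem {b : ℕ} (hb : Even b) (hb0 : b ≠ 0) {x : ℝ} (hx : 0 < x)
    (s : ℂ) : MellinConvergent
    (fun t => ((powThetaRem b t * Real.exp (-x * t) : ℝ) : ℂ)) s := by
  obtain ⟨K, h1, h2, h3, h4⟩ := isBigO_powThetaRem_mul_exp hb hb0 hx s
  exact mellinConvergent_of_isBigO_rpow_exp (half_pos hx) h1 h2 h3 h4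

theorem differentiable_powThetaMellin {b : ℕ} (hb : Even b) (hb0 : b ≠ 0) {x : ℝ} (hx : 0 < x) :
    Differentiable ℂ (powThetaMellin b x) := by
  intro s
  obtain ⟨K, h1, h2, h3, h4⟩ := isBigO_powThetaRem_mul_exp hb hb0 hx s
  exact mellin_differentiableAt_of_isBigO_rpow_exp (half_pos hx) h1 h2 h3 h4

/-- Integrating the bound `C t^K` produces a Gamma integral. Since `K` is free, this is decay in `x`
of arbitrary order, which makes the sum over `x = m^a` converge everywhere. -/
theorem norm_powThetaMellin_le {b : ℕ} (hb : Even b) (hb0 : b ≠ 0) {K : ℕ} (hK : 1 ≤ K) :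
    ∃ C : ℝ, ∀ (x : ℝ) (s : ℂ), 0 < x → 0 < s.re + K →
      ‖powThetaMellin b x s‖ ≤ C * Real.Gamma (s.re + K) * x ^ (-(s.re + K)) := by
  obtain ⟨C, hC⟩ := abs_powThetaRem_le hb hb0 hK
  refine ⟨C, fun x s hx hs => ?_⟩
  have h1 := Real.integral_rpow_mul_exp_neg_mul_Ioi hs hx
  have hint : MeasureTheory.IntegrableOn
      (fun t : ℝ => t ^ (s.re + K - 1) * Real.exp (-(x * t))) (Set.Ioi 0) := by
    have := integrableOn_rpow_mul_exp_neg_mul_rpow (s := s.re + K - 1) (p := 1) (b := x)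
      (by linarith) one_pos hx
    simpa using this
  have h2 : C * Real.Gamma (s.re + K) * x ^ (-(s.re + K)) =
      ∫ t in Set.Ioi (0 : ℝ), C * (t ^ (s.re + K - 1) * Real.exp (-(x * t))) := by
    rw [MeasureTheory.integral_const_mul, h1, one_div, Real.inv_rpow hx.le, Real.rpow_neg hx.le]
    ring
  rw [h2]
  refine MeasureTheory.norm_integral_le_of_norm_le (hint.const_mul C) ?_
  filter_upwards [MeasureTheory.ae_restrict_mem measurableSet_Ioi] with t ht
  have ht' : 0 < t := ht
  rw [norm_smul, Complex.norm_cpow_eq_rpow_re_of_pos ht', Complex.norm_real, norm_mul,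
    Real.norm_eq_abs, Real.norm_eq_abs, Real.abs_exp, Complex.sub_re, Complex.one_re]
  calc t ^ (s.re - 1) * (|powThetaRem b t| * Real.exp (-x * t))
      ≤ t ^ (s.re - 1) * ((C * t ^ K) * Real.exp (-x * t)) := by
        gcongr
        exact hC t ht'
    _ = C * (t ^ (s.re + K - 1) * Real.exp (-(x * t))) := by
        rw [show s.re + K - 1 = (s.re - 1) + K by ring, Real.rpow_add ht', Real.rpow_natCast]
        ring_nf

theorem hasMellin_exp_neg_mul {x : ℝ} (hx : 0 < x) {s : ℂ} (hs : 0 < s.re) :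
    HasMellin (fun t : ℝ => Complex.exp (-(x * t))) s ((x : ℂ) ^ (-s) * Complex.Gamma s) := by
  have h1 : (1 / x : ℂ) ^ s = (x : ℂ) ^ (-s) := by
    have harg : (x : ℂ).arg ≠ Real.pi := by
      rw [Complex.arg_ofReal_of_nonneg hx.le]
      exact Real.pi_pos.ne
    rw [one_div, Complex.inv_cpow _ _ harg, Complex.cpow_neg]
  refine ⟨?_, ?_⟩
  · refine mellinConvergent_of_isBigO_rpow_exp hx (b := 0) ?_ ?_ ?_ hs
    · have hc : Continuous fun t : ℝ => Complex.exp (-(x * t)) := by fun_prop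
      exact hc.locallyIntegrable.locallyIntegrableOn _
    · refine Asymptotics.IsBigO.of_bound 1 (Eventually.of_forall fun t => ?_)
      rw [Complex.norm_exp]
      simp
    · refine Asymptotics.IsBigO.of_bound 1 ?_
      filter_upwards [self_mem_nhdsWithin] with t ht
      have ht' : 0 < t := ht
      rw [Complex.norm_exp]
      simp
      positivity
  · rw [mellin, ← h1, ← Complex.integral_cpow_mul_exp_neg_mul_Ioi hs hx]
    simp

/-- Termwise, `Γ(s) (x + n^b)^(-s)` is the Mellin transform of `exp (-(x + n^b) t)`; the sum over
`n` is the theta series times `exp (-x t)`, whose three pieces are transformed separately. -/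
theorem hasSum_nat_pow_add_cpow {b : ℕ} (hb : Even b) (hb0 : b ≠ 0) {x : ℝ} (hx : 0 < x) {s : ℂ}
    (hs : 1 / (b : ℝ) < s.re) :
    HasSum (fun n : ℕ+ => ((x + (n : ℝ) ^ b : ℝ) : ℂ) ^ (-s))
      ((Complex.Gamma s)⁻¹ * (Real.Gamma (1 / b + 1) * Complex.Gamma (s - 1 / b) *
        (x : ℂ) ^ (-(s - 1 / b)) + powThetaMellin b x s) - 1 / 2 * (x : ℂ) ^ (-s)) := by
  have hb1 : (0 : ℝ) < b := by positivity
  have hs0 : 0 < s.re := lt_trans (by positivity) hs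
  have hG : Complex.Gamma s ≠ 0 := Complex.Gamma_ne_zero_of_re_pos hs0
  have hre : (s - 1 / b).re = s.re - 1 / b := by
    rw [Complex.sub_re, show (1 / b : ℂ) = ((1 / b : ℝ) : ℂ) by push_cast; rfl, Complex.ofReal_re]
  have H0 := hasMellin_exp_neg_mul hx hs0
  have H1 := hasMellin_exp_neg_mul hx (s := s - 1 / b) (by rw [hre]; linarith)
  have H2 : HasMellin (fun t : ℝ => (t : ℂ) ^ (-(1 / b : ℂ)) • Complex.exp (-(x * t))) s
      ((x : ℂ) ^ (-(s - 1 / b)) * Complex.Gamma (s - 1 / b)) := by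
    refine ⟨MellinConvergent.cpow_smul.2 ?_, ?_⟩
    · rw [← sub_eq_add_neg]; exact H1.1
    · rw [mellin_cpow_smul, ← sub_eq_add_neg, H1.2]
  have H3 := mellinConvergent_powThetaRem hb hb0 hx s
  have H5 := hasMellin_sub (hasMellin_const_smul H2.1
    (Real.Gamma (1 / b + 1) : ℂ)).1 (hasMellin_const_smul H0.1 (1 / 2 : ℂ)).1
  have H4 := hasMellin_add H5.1 H3
  have hp : ∀ n : ℕ+, 0 < x + (n : ℝ) ^ b := fun n => by positivity
  have hsum : Summable fun n : ℕ+ => ‖(1 : ℂ)‖ / (x + (n : ℝ) ^ b) ^ s.re := by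
    have h1 : Summable fun n : ℕ => 1 / (n : ℝ) ^ (b * s.re) := by
      refine Real.summable_one_div_nat_rpow.2 ?_
      rwa [div_lt_iff₀' hb1] at hs
    refine (h1.comp_injective PNat.coe_injective).of_nonneg_of_le (fun n => ?_) fun n => ?_
    · have := hp n
      positivity
    · rw [norm_one, Function.comp_apply, Real.rpow_mul (by positivity), Real.rpow_natCast]
      gcongr
      linarith
  have hM := hasSum_mellin (a := fun _ : ℕ+ => (1 : ℂ)) (p := fun n : ℕ+ => x + (n : ℝ) ^ b)
    (F := fun t => ((powTheta b t * Real.exp (-x * t) : ℝ) : ℂ)) (s := s)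
    (fun n => Or.inr (hp n)) hs0 (fun t ht => by
      have h1 := ((summable_exp_neg_mul_pow hb0 (show 0 < t from ht)).hasSum.mul_right
        (Real.exp (-x * t))).mapL Complex.ofRealCLM
      convert! h1 using 2 with n
      simp only [Complex.ofRealCLM_apply, one_mul]
      rw [← Real.exp_add]
      ring_nf) hsum
  have hF : mellin (fun t => ((powTheta b t * Real.exp (-x * t) : ℝ) : ℂ)) s = _ :=
    Eq.trans ?_ H4.2
  · rw [H5.2, mellin_const_smul, mellin_const_smul] at hF
    rw [hF, H2.2, H0.2] at hM
    convert! hM.mul_left (Complex.Gamma s)⁻¹ using 1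
    · funext n
      rw [Complex.cpow_neg]
      field_simp
    · rw [powThetaMellin, smul_eq_mul, smul_eq_mul]
      field_simp
      ring
  · refine MeasureTheory.setIntegral_congr_fun measurableSet_Ioi fun t ht => ?_
    have ht' : 0 < t := ht
    congr 1
    simp only [powThetaRem, smul_eq_mul]
    have hpow : ((t ^ (-(1 / b : ℝ)) : ℝ) : ℂ) = (t : ℂ) ^ (-(1 / b : ℂ)) := by
      rw [Complex.ofReal_cpow ht'.le]
      push_cast
      rfl
    rw [← hpow]
    push_cast
    ring_nf

/-! ### Holomorphy of the remainder in both variables. -/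

/-- Holomorphy in two variables of a series of products, obtained from the one-variable theory
with values in `ℓ²` and in its dual. -/
theorem analyticAt_tsum_mul {ι : Type*} {f g : ι → ℂ → ℂ} {u v : ι → ℝ} {U V : Set ℂ}
    (hU : IsOpen U) (hV : IsOpen V) (hf : ∀ i, DifferentiableOn ℂ (f i) U)
    (hg : ∀ i, DifferentiableOn ℂ (g i) V) (hu : Summable u) (hv : Summable v)
    (hfu : ∀ i, ∀ z ∈ U, ‖f i z‖ ≤ u i) (hgv : ∀ i, ∀ z ∈ V, ‖g i z‖ ≤ v i) {p : Fin 2 → ℂ}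
    (hp0 : p 0 ∈ U) (hp1 : p 1 ∈ V) :
    AnalyticAt ℂ (fun z : Fin 2 → ℂ => ∑' i, f i (z 0) * g i (z 1)) p := by
  classical
  let X := lp (fun _ : ι => ℂ) 2
  let ev : ι → (X →L[ℂ] ℂ) := fun i => lp.evalCLM ℂ (fun _ : ι => ℂ) 2 i
  let e : ι → X := fun i => lp.single 2 i (1 : ℂ)
  have hev : ∀ i, ‖ev i‖ ≤ 1 := fun i => LinearMap.mkContinuous_norm_le _ zero_le_one _
  have he : ∀ i, ‖e i‖ = 1 := fun i => by
    rw [lp.norm_single (by norm_num)]; simp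
  have hev_e : ∀ i j, ev i (e j) = if i = j then 1 else 0 := fun i j => by
    change (lp.single 2 j (1 : ℂ) : X) i = _
    rw [lp.single_apply]
    simp [Pi.single_apply]
  -- The series is the pairing of `Φ (z 0)` with `Ψ (z 1)`. Each is a norm-convergent series in one
  -- variable, and a bounded bilinear map preserves analyticity.
  let Φ : ℂ → (X →L[ℂ] ℂ) := fun z => ∑' i, f i z • ev i
  let Ψ : ℂ → X := fun z => ∑' i, g i z • e i
  have hΦle : ∀ i, ∀ z ∈ U, ‖f i z • ev i‖ ≤ u i := fun i z hz => by
    rw [norm_smul]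
    exact (mul_le_of_le_one_right (norm_nonneg _) (hev i)).trans (hfu i z hz)
  have hΨle : ∀ i, ∀ z ∈ V, ‖g i z • e i‖ ≤ v i := fun i z hz => by
    rw [norm_smul, he, mul_one]
    exact hgv i z hz
  have hΦ : DifferentiableOn ℂ Φ U :=
    Complex.differentiableOn_tsum_of_summable_norm hu (fun i => (hf i).smul_const _) hU hΦle
  have hΨ : DifferentiableOn ℂ Ψ V :=
    Complex.differentiableOn_tsum_of_summable_norm hv (fun i => (hg i).smul_const _) hV hΨle
  have hΦa : AnalyticAt ℂ (fun z : Fin 2 → ℂ => Φ (z 0)) p :=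
    (hΦ.analyticAt (hU.mem_nhds hp0)).comp_of_eq
      ((ContinuousLinearMap.proj (R := ℂ) (φ := fun _ : Fin 2 => ℂ) 0).analyticAt p) rfl
  have hΨa : AnalyticAt ℂ (fun z : Fin 2 → ℂ => Ψ (z 1)) p :=
    (hΨ.analyticAt (hV.mem_nhds hp1)).comp_of_eq
      ((ContinuousLinearMap.proj (R := ℂ) (φ := fun _ : Fin 2 => ℂ) 1).analyticAt p) rfl
  refine (((ContinuousLinearMap.id ℂ (X →L[ℂ] ℂ)).analyticAt_bilinear _).comp₂ hΦa hΨa).congr ?_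
  have h0 : ∀ᶠ z : Fin 2 → ℂ in 𝓝 p, z 0 ∈ U :=
    (continuous_apply 0).continuousAt.eventually_mem (hU.mem_nhds hp0)
  have h1 : ∀ᶠ z : Fin 2 → ℂ in 𝓝 p, z 1 ∈ V :=
    (continuous_apply 1).continuousAt.eventually_mem (hV.mem_nhds hp1)
  filter_upwards [h0, h1] with z hz0 hz1
  have hsΦ : Summable fun i => f i (z 0) • ev i :=
    Summable.of_norm_bounded hu fun i => hΦle i _ hz0
  have hsΨ : Summable fun i => g i (z 1) • e i :=
    Summable.of_norm_bounded hv fun i => hΨle i _ hz1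
  have key : ∀ i, ev i (Ψ (z 1)) = g i (z 1) := fun i => by
    rw [(ev i).map_tsum hsΨ, tsum_eq_single i]
    · simp [hev_e]
    · intro j hj
      simp [hev_e, hj.symm]
  have h3 := (hsΦ.hasSum.mapL (ContinuousLinearMap.apply ℂ ℂ (Ψ (z 1)))).tsum_eq
  refine h3.symm.trans (tsum_congr fun i => ?_)
  simp [key]

/-- The remainder of the double zeta series, an entire function. -/
noncomputable def doubleZetaRem (a b : ℕ) (s : Fin 2 → ℂ) : ℂ :=
  ∑' m : ℕ+, ((m : ℕ) : ℂ) ^ (-(a * s 0)) * powThetaMellin b ((m : ℝ) ^ a) (s 1)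

theorem summable_pnat_inv_sq : Summable fun m : ℕ+ => 1 / (m : ℝ) ^ 2 :=
  (Real.summable_one_div_nat_pow.2 one_lt_two).comp_injective PNat.coe_injective

/-- Splitting of the terms of the remainder into factors with summable bounds. -/
theorem doubleZetaRem_bounds {a b : ℕ} (ha : a ≠ 0) (hb : Even b) (hb0 : b ≠ 0) (p : Fin 2 → ℂ) :
    ∃ (A : ℕ) (D : ℝ),
      (∀ m : ℕ+, ∀ z ∈ Metric.ball (p 0) 1,
        ‖((m : ℕ) : ℂ) ^ (-(a * z + A))‖ ≤ 1 / (m : ℝ) ^ 2) ∧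
      (∀ m : ℕ+, ∀ z ∈ Metric.ball (p 1) 1,
        ‖((m : ℕ) : ℂ) ^ A * powThetaMellin b ((m : ℝ) ^ a) z‖ ≤ D * (1 / (m : ℝ) ^ 2)) := by
  have ha1 : (1 : ℝ) ≤ a := by exact_mod_cast Nat.one_le_iff_ne_zero.2 ha
  -- `A` forces `Re (a z + A) > 2` on the first ball; `K` then forces `Re z + K > A + 2` on the
  -- second, paying for the compensating factor `m^A`.
  obtain ⟨A, hA⟩ := exists_nat_gt (2 - a * ((p 0).re - 1))
  obtain ⟨K, hK⟩ := exists_nat_gt (max 1 (A + 2 - ((p 1).re - 1)))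
  have hK1 : 1 ≤ K := by
    have := (le_max_left _ _).trans_lt hK
    exact_mod_cast this.le
  have hK2 := (le_max_right _ _).trans_lt hK
  obtain ⟨C, hC⟩ := norm_powThetaMellin_le hb hb0 hK1
  have hcont : ContinuousOn Real.Gamma (Set.Icc ((p 1).re - 1 + K) ((p 1).re + 1 + K)) := by
    refine continuousOn_of_forall_continuousAt fun x hx => ?_
    have : (0 : ℝ) ≤ A := Nat.cast_nonneg A
    refine (Real.differentiableAt_Gamma fun m => ?_).continuousAt
    have : (0 : ℝ) ≤ m := Nat.cast_nonneg m
    have := hx.1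
    intro h
    linarith
  obtain ⟨D, hD⟩ := isCompact_Icc.exists_bound_of_continuousOn hcont
  have hball : ∀ w z : ℂ, z ∈ Metric.ball w 1 → |z.re - w.re| < 1 := fun w z hz => by
    rw [← Complex.sub_re]
    exact (Complex.abs_re_le_norm _).trans_lt (by simpa [dist_eq_norm] using hz)
  have hm1 : ∀ m : ℕ+, (1 : ℝ) ≤ m := fun m => by exact_mod_cast m.pos
  refine ⟨A, |C| * D, fun m z hz => ?_, fun m z hz => ?_⟩
  · have hz' := abs_lt.1 (hball _ _ hz)
    rw [Complex.norm_natCast_cpow_of_pos m.pos, one_div, ← Real.rpow_natCast,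
      ← Real.rpow_neg (by positivity)]
    refine Real.rpow_le_rpow_of_exponent_le (hm1 m) ?_
    simp only [Complex.neg_re, Complex.add_re, Complex.natCast_re, Complex.mul_re,
      Complex.natCast_im, Nat.cast_ofNat]
    nlinarith
  · have hz' := abs_lt.1 (hball _ _ hz)
    have hpos : (0 : ℝ) ≤ A := Nat.cast_nonneg A
    have hm0 : (0 : ℝ) < m := lt_of_lt_of_le one_pos (hm1 m)
    have hR := hC ((m : ℝ) ^ a) z (by positivity) (by linarith)
    have hG := hD (z.re + K) ⟨by linarith, by linarith⟩
    rw [norm_mul, norm_pow, Complex.norm_natCast]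
    have hx : ((m : ℝ) ^ a) ^ (-(z.re + K)) ≤ (m : ℝ) ^ (-((A : ℝ) + 2)) := by
      rw [← Real.rpow_natCast, ← Real.rpow_mul hm0.le]
      refine Real.rpow_le_rpow_of_exponent_le (hm1 m) ?_
      nlinarith
    have hD0 : 0 ≤ D := (norm_nonneg _).trans hG
    have h5 : C * Real.Gamma (z.re + K) * ((m : ℝ) ^ a) ^ (-(z.re + K)) ≤
        |C| * D * (m : ℝ) ^ (-((A : ℝ) + 2)) := by
      gcongr
      · exact Real.Gamma_nonneg_of_nonneg (by linarith)
      · exact le_abs_self C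
      · exact (le_abs_self _).trans hG
    calc (m : ℝ) ^ A * ‖powThetaMellin b ((m : ℝ) ^ a) z‖
        ≤ (m : ℝ) ^ A * (|C| * D * (m : ℝ) ^ (-((A : ℝ) + 2))) := by
          gcongr
          exact hR.trans h5
      _ = |C| * D * (1 / (m : ℝ) ^ 2) := by
          rw [Real.rpow_neg hm0.le, Real.rpow_add hm0, Real.rpow_natCast, Real.rpow_two]
          field_simp

theorem doubleZetaRem_term_eq {a b : ℕ} (A : ℕ) (m : ℕ+) (z w : ℂ) :
    ((m : ℕ) : ℂ) ^ (-(a * z + A)) * (((m : ℕ) : ℂ) ^ A * powThetaMellin b ((m : ℝ) ^ a) w) =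
      ((m : ℕ) : ℂ) ^ (-(a * z)) * powThetaMellin b ((m : ℝ) ^ a) w := by
  have hm : ((m : ℕ) : ℂ) ≠ 0 := by exact_mod_cast m.ne_zero
  rw [neg_add, Complex.cpow_add _ _ hm, Complex.cpow_neg _ (A : ℂ), Complex.cpow_natCast]
  field_simp

theorem summable_doubleZetaRem {a b : ℕ} (ha : a ≠ 0) (hb : Even b) (hb0 : b ≠ 0)
    (s : Fin 2 → ℂ) :
    Summable fun m : ℕ+ => ((m : ℕ) : ℂ) ^ (-(a * s 0)) * powThetaMellin b ((m : ℝ) ^ a) (s 1) := by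
  obtain ⟨A, D, h1, h2⟩ := doubleZetaRem_bounds ha hb hb0 s
  refine Summable.of_norm_bounded (summable_pnat_inv_sq.mul_left D) fun m => ?_
  rw [← doubleZetaRem_term_eq A, norm_mul]
  have e1 := h1 m _ (Metric.mem_ball_self one_pos)
  have e2 := h2 m _ (Metric.mem_ball_self one_pos)
  have e3 : 1 / (m : ℝ) ^ 2 ≤ 1 := by
    have : (1 : ℝ) ≤ m := by exact_mod_cast m.pos
    exact div_le_one_of_le₀ (one_le_pow₀ this) (by positivity)
  exact (mul_le_of_le_one_left (norm_nonneg _) (e1.trans e3)).trans e2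

theorem analyticAt_doubleZetaRem {a b : ℕ} (ha : a ≠ 0) (hb : Even b) (hb0 : b ≠ 0)
    (p : Fin 2 → ℂ) : AnalyticAt ℂ (doubleZetaRem a b) p := by
  obtain ⟨A, D, h1, h2⟩ := doubleZetaRem_bounds ha hb hb0 p
  have := analyticAt_tsum_mul Metric.isOpen_ball Metric.isOpen_ball
    (f := fun (m : ℕ+) z => ((m : ℕ) : ℂ) ^ (-(a * z + A)))
    (g := fun (m : ℕ+) z => ((m : ℕ) : ℂ) ^ A * powThetaMellin b ((m : ℝ) ^ a) z)
    (fun m => ?_) (fun m => ?_) summable_pnat_inv_sq (summable_pnat_inv_sq.mul_left D) h1 h2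
    (Metric.mem_ball_self one_pos) (Metric.mem_ball_self one_pos)
  · simp_rw [doubleZetaRem_term_eq] at this
    exact this
  · have hm : ((m : ℕ) : ℂ) ≠ 0 := by exact_mod_cast m.ne_zero
    exact Differentiable.differentiableOn
      ((by fun_prop : Differentiable ℂ fun z : ℂ => -((a : ℂ) * z + A)).const_cpow (Or.inl hm))
  · have hm : (0 : ℝ) < (m : ℝ) ^ a := by
      have : (0 : ℝ) < m := by exact_mod_cast m.pos
      positivity
    exact ((differentiable_powThetaMellin hb hb0 hm).const_mul _).differentiableOn

/-! ### The explicit continuation and its agreement with the series. -/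

/-- The meromorphic continuation of the double zeta series
`∑ (m ^ a) ^ (-s₀) (m ^ a + n ^ b) ^ (-s₁)`. -/
noncomputable def doubleZeta (a b : ℕ) (s : Fin 2 → ℂ) : ℂ :=
  (Complex.Gamma (s 1))⁻¹ * (Real.Gamma (1 / b + 1) * Complex.Gamma (s 1 - 1 / b) *
    riemannZeta (a * (s 0 + s 1 - 1 / b)) + doubleZetaRem a b s) -
    1 / 2 * riemannZeta (a * (s 0 + s 1))

theorem hasSum_pnat_riemannZeta {w : ℂ} (hw : 1 < w.re) :
    HasSum (fun m : ℕ+ => ((m : ℕ) : ℂ) ^ (-w)) (riemannZeta w) := by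
  have hs := Complex.summable_one_div_nat_cpow.2 hw
  have h1 : (fun m : ℕ+ => ((m : ℕ) : ℂ) ^ (-w)) = fun m : ℕ+ => 1 / ((m : ℕ) : ℂ) ^ w := by
    funext m
    rw [Complex.cpow_neg, one_div]
  have hw0 : w ≠ 0 := by
    rintro rfl
    simp at hw
    linarith
  rw [h1, hasSum_pnat_iff (f := fun n : ℕ => 1 / (n : ℂ) ^ w), zeta_eq_tsum_one_div_nat_cpow hw]
  simpa [hw0] using hs.hasSum

theorem pow_cpow_pnat (m : ℕ+) (a : ℕ) (w : ℂ) :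
    (((m : ℕ) : ℂ) ^ a) ^ w = ((m : ℕ) : ℂ) ^ (a * w) := by
  have h := Complex.cpow_mul_ofReal_nonneg (Nat.cast_nonneg (α := ℝ) m) a w
  simpa using h.symm

/-- The sum of the double zeta series over the second variable. -/
noncomputable def doubleZetaRow (a b : ℕ) (s : Fin 2 → ℂ) (m : ℕ+) : ℂ :=
  (Complex.Gamma (s 1))⁻¹ * (Real.Gamma (1 / b + 1) * Complex.Gamma (s 1 - 1 / b) *
    ((m : ℕ) : ℂ) ^ (-(a * (s 0 + s 1 - 1 / b))) +
    ((m : ℕ) : ℂ) ^ (-(a * s 0)) * powThetaMellin b ((m : ℝ) ^ a) (s 1)) -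
    1 / 2 * ((m : ℕ) : ℂ) ^ (-(a * (s 0 + s 1)))

theorem mem_multiZetaDomain_two {a b : ℕ} {s : Fin 2 → ℂ} :
    s ∈ multiZetaDomain ![a, b] ↔
      1 / (a : ℝ) + 1 / b < (s 0).re + (s 1).re ∧ 1 / (b : ℝ) < (s 1).re := by
  have h0 : Finset.Ici (0 : Fin 2) = {0, 1} := by decide
  have h1 : Finset.Ici (1 : Fin 2) = {1} := by decide
  simp [multiZetaDomain, Fin.forall_fin_two, h0, h1]

theorem multiZetaTerm_two (a b : ℕ) (s : Fin 2 → ℂ) (m : Fin 2 → ℕ+) :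
    multiZetaTerm ![a, b] ![1, 1] s m = ((m 0 : ℕ) : ℂ) ^ (-(a * s 0)) *
      (((m 0 : ℝ) ^ a + (m 1 : ℝ) ^ b : ℝ) : ℂ) ^ (-s 1) := by
  have h0 : Finset.Iic (0 : Fin 2) = {0} := by decide
  have h1 : Finset.Iic (1 : Fin 2) = {0, 1} := by decide
  simp [multiZetaTerm, Fin.prod_univ_two, h0, h1, pow_cpow_pnat]

theorem hasSum_doubleZetaRow_snd {a b : ℕ} (hb : Even b) (hb0 : b ≠ 0) {s : Fin 2 → ℂ}
    (hs : 1 / (b : ℝ) < (s 1).re) (m : ℕ+) :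
    HasSum (fun n : ℕ+ => multiZetaTerm ![a, b] ![1, 1] s ![m, n]) (doubleZetaRow a b s m) := by
  have hm : ((m : ℕ) : ℂ) ≠ 0 := by exact_mod_cast m.ne_zero
  have hm' : (0 : ℝ) < m := by exact_mod_cast m.pos
  have h := (hasSum_nat_pow_add_cpow hb hb0 (x := (m : ℝ) ^ a) (by positivity) hs).mul_left
    (((m : ℕ) : ℂ) ^ (-(a * s 0)))
  have e : ∀ w : ℂ, (((m : ℝ) ^ a : ℝ) : ℂ) ^ w = ((m : ℕ) : ℂ) ^ (a * w) := fun w => by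
    rw [← pow_cpow_pnat]
    push_cast
    rfl
  have e2 : ∀ w : ℂ, ((m : ℕ) : ℂ) ^ (-(a * (s 0 + w))) =
      ((m : ℕ) : ℂ) ^ (-(a * s 0)) * ((m : ℕ) : ℂ) ^ (a * (-w)) := fun w => by
    rw [← Complex.cpow_add _ _ hm]
    ring_nf
  simp_rw [multiZetaTerm_two]
  convert! h using 1
  rw [doubleZetaRow, add_sub_assoc, e2, e2, e, e]
  ring

theorem hasSum_doubleZetaRow {a b : ℕ} (ha : a ≠ 0) (hb : Even b) (hb0 : b ≠ 0) {s : Fin 2 → ℂ}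
    (hs : s ∈ multiZetaDomain ![a, b]) : HasSum (doubleZetaRow a b s) (doubleZeta a b s) := by
  obtain ⟨h1, h2⟩ := mem_multiZetaDomain_two.1 hs
  have ha' : (0 : ℝ) < a := by positivity
  have hb' : (0 : ℝ) < 1 / b := by positivity
  have hre : (1 / b : ℂ).re = 1 / (b : ℝ) := by
    rw [show (1 / b : ℂ) = ((1 / b : ℝ) : ℂ) by push_cast; rfl, Complex.ofReal_re]
  have z1 : HasSum _ _ := hasSum_pnat_riemannZeta (w := a * (s 0 + s 1 - 1 / b)) (by
    have : 1 / (a : ℝ) < (s 0).re + (s 1).re - 1 / b := by linarith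
    rw [div_lt_iff₀' ha'] at this
    rw [← Complex.ofReal_natCast, Complex.re_ofReal_mul, Complex.sub_re, Complex.add_re, hre]
    exact this)
  have z2 : HasSum _ _ := hasSum_pnat_riemannZeta (w := a * (s 0 + s 1)) (by
    have : 1 / (a : ℝ) < (s 0).re + (s 1).re := by linarith
    rw [div_lt_iff₀' ha'] at this
    rw [← Complex.ofReal_natCast, Complex.re_ofReal_mul, Complex.add_re]
    exact this)
  have z3 := (summable_doubleZetaRem ha hb hb0 s).hasSum
  exact (((z1.mul_left _).add z3).mul_left _).sub (z2.mul_left _)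

/-- All bases are positive reals, so absolute convergence at `s` is convergence at its real part,
where the row sums are already known. -/
theorem ofReal_norm_multiZetaTerm_two (a b : ℕ) (s : Fin 2 → ℂ) (m : Fin 2 → ℕ+) :
    (‖multiZetaTerm ![a, b] ![1, 1] s m‖ : ℂ) =
      multiZetaTerm ![a, b] ![1, 1] (fun i => ((s i).re : ℂ)) m := by
  have h0 : (0 : ℝ) < m 0 := by exact_mod_cast (m 0).pos
  have h1 : (0 : ℝ) < m 1 := by exact_mod_cast (m 1).pos
  rw [multiZetaTerm_two, multiZetaTerm_two, norm_mul, Complex.norm_natCast_cpow_of_pos (m 0).pos,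
    Complex.norm_cpow_eq_rpow_re_of_pos (by positivity), Complex.ofReal_mul,
    Complex.ofReal_cpow h0.le, Complex.ofReal_cpow (by positivity)]
  congr 2
  · simp
  · simp

theorem hasSum_multiZetaTerm_two {a b : ℕ} (ha : a ≠ 0) (hb : Even b) (hb0 : b ≠ 0)
    {s : Fin 2 → ℂ} (hs : s ∈ multiZetaDomain ![a, b]) :
    HasSum (multiZetaTerm ![a, b] ![1, 1] s) (doubleZeta a b s) := by
  have hs' := mem_multiZetaDomain_two.1 hs
  set s' : Fin 2 → ℂ := fun i => ((s i).re : ℂ) with hs'_def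
  have hd' : s' ∈ multiZetaDomain ![a, b] := by
    rw [mem_multiZetaDomain_two]
    simpa [hs'_def] using hs'
  set T : ℕ+ × ℕ+ → ℂ := fun q => multiZetaTerm ![a, b] ![1, 1] s ![q.1, q.2] with hT
  have hrow : ∀ m : ℕ+, HasSum (fun n : ℕ+ => (‖T (m, n)‖ : ℂ)) (doubleZetaRow a b s' m) := by
    intro m
    simp_rw [hT, ofReal_norm_multiZetaTerm_two]
    exact hasSum_doubleZetaRow_snd hb hb0 (mem_multiZetaDomain_two.1 hd').2 m
  -- For nonnegative terms, summability of the rows and of the row sums suffices; summability of `T`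
  -- then licenses summing by rows.
  have hsum : Summable T := by
    refine Summable.of_norm ?_
    rw [summable_prod_of_nonneg fun q => norm_nonneg _]
    refine ⟨fun m => Complex.summable_ofReal.1 (hrow m).summable, ?_⟩
    rw [← Complex.summable_ofReal]
    refine (hasSum_doubleZetaRow ha hb hb0 hd').summable.congr fun m => ?_
    rw [Complex.ofReal_tsum]
    exact (hrow m).tsum_eq.symm
  have hT' : HasSum T (doubleZeta a b s) := by
    have h := hsum.hasSum.prod_fiberwise fun m => hasSum_doubleZetaRow_snd hb hb0 hs'.2 m
    rw [← h.unique (hasSum_doubleZetaRow ha hb hb0 hs)]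
    exact hsum.hasSum
  rw [← (finTwoArrowEquiv ℕ+).symm.hasSum_iff]
  exact hT'

/-! ### The identity theorem for meromorphic functions. -/

theorem not_eventually_zero_mul {n : ℕ} {f g : (Fin n → ℂ) → ℂ} {p : Fin n → ℂ}
    (hf : AnalyticAt ℂ f p) (hg : AnalyticAt ℂ g p) (hf0 : ¬ ∀ᶠ z in 𝓝 p, f z = 0)
    (hg0 : ¬ ∀ᶠ z in 𝓝 p, g z = 0) : ¬ ∀ᶠ z in 𝓝 p, f z * g z = 0 := fun h =>
  hg0 (eventually_zero_of_mul hf hg hf0 (h.mono fun _ hz h0 => (mul_eq_zero.1 hz).resolve_left h0))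

theorem not_eventually_zero_of_ball {n : ℕ} {h : (Fin n → ℂ) → ℂ} {p q : Fin n → ℂ} {r : ℝ}
    (hh : ∀ z ∈ Metric.ball p r, AnalyticAt ℂ h z) (hq : q ∈ Metric.ball p r)
    (h0 : ¬ ∀ᶠ z in 𝓝 p, h z = 0) : ¬ ∀ᶠ z in 𝓝 q, h z = 0 := by
  intro hz
  have hr : 0 < r := Metric.pos_of_mem_ball hq
  have hEq := AnalyticOnNhd.eqOn_zero_of_preconnected_of_eventuallyEq_zero (𝕜 := ℂ)
    hh (convex_ball p r).isPreconnected hq hz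
  exact h0 (eventually_of_mem (Metric.ball_mem_nhds p hr) fun z hz' => hEq hz')

/-- Near every point, two meromorphic functions agree off a thin set at all points, or at none. -/
theorem exists_ball_eqOffThin {n : ℕ} {F G : (Fin n → ℂ) → ℂ} {p : Fin n → ℂ}
    (hF : IsMeromorphicAt F p) (hG : IsMeromorphicAt G p) :
    ∃ r > 0, ∀ q ∈ Metric.ball p r, EqOffThin F G q → ∀ w ∈ Metric.ball p r, EqOffThin F G w := by
  obtain ⟨f, k, hf, hk, hk0, hFk⟩ := hF
  obtain ⟨g, l, hg, hl, hl0, hGl⟩ := hG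
  obtain ⟨r, hr, hb⟩ := Metric.eventually_nhds_iff_ball.1 (hf.eventually_analyticAt.and
    (hk.eventually_analyticAt.and (hFk.and (hg.eventually_analyticAt.and
      (hl.eventually_analyticAt.and hGl)))))
  refine ⟨r, hr, fun q hq ⟨h, hh, hh0, hFG⟩ w hw => ?_⟩
  have ha : ∀ z ∈ Metric.ball p r, AnalyticAt ℂ (fun z => k z * l z) z := fun z hz =>
    (hb z hz).2.1.mul (hb z hz).2.2.2.2.1
  have ha0 := not_eventually_zero_mul hk hl hk0 hl0
  have hd : ∀ z ∈ Metric.ball p r, AnalyticAt ℂ (fun z => f z * l z - g z * k z) z := fun z hz =>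
    ((hb z hz).1.mul (hb z hz).2.2.2.2.1).sub ((hb z hz).2.2.2.1.mul (hb z hz).2.1)
  -- Clearing denominators turns agreement of `f / k` and `g / l` into the vanishing of one
  -- holomorphic function, which spreads from near `q` to the whole ball.
  have hdq : ∀ᶠ z in 𝓝 q, f z * l z - g z * k z = 0 := by
    refine eventually_zero_of_mul (hh.mul (ha q hq)) (hd q hq)
      (not_eventually_zero_mul hh (ha q hq) hh0 (not_eventually_zero_of_ball ha hq ha0)) ?_
    filter_upwards [hFG, Metric.isOpen_ball.mem_nhds hq] with z h1 hz h2
    obtain ⟨h3, h4⟩ := mul_ne_zero_iff.1 h2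
    obtain ⟨h5, h6⟩ := mul_ne_zero_iff.1 h4
    have e := h1 h3
    rw [(hb z hz).2.2.1 h5, (hb z hz).2.2.2.2.2 h6, div_eq_div_iff h5 h6] at e
    exact sub_eq_zero.2 e
  have hEq := AnalyticOnNhd.eqOn_zero_of_preconnected_of_eventuallyEq_zero (𝕜 := ℂ)
    hd (convex_ball p r).isPreconnected hq hdq
  refine ⟨_, ha w hw, not_eventually_zero_of_ball ha hw ha0, ?_⟩
  filter_upwards [Metric.isOpen_ball.mem_nhds hw] with z hz h2
  obtain ⟨h5, h6⟩ := mul_ne_zero_iff.1 h2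
  rw [(hb z hz).2.2.1 h5, (hb z hz).2.2.2.2.2 h6, div_eq_div_iff h5 h6]
  exact sub_eq_zero.1 (hEq hz)

/-- The identity theorem for meromorphic functions on `ℂⁿ`. -/
theorem eqOffThin_of_eventuallyEq {n : ℕ} {F G : (Fin n → ℂ) → ℂ}
    (hF : ∀ p, IsMeromorphicAt F p) (hG : ∀ p, IsMeromorphicAt G p) {p₀ : Fin n → ℂ}
    (h : F =ᶠ[𝓝 p₀] G) (p : Fin n → ℂ) : EqOffThin F G p := by
  -- The local dichotomy makes both this set and its complement open, and `ℂⁿ` is connected.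
  have hclopen : IsClopen {q | EqOffThin F G q} := by
    refine ⟨⟨?_⟩, ?_⟩ <;> refine isOpen_iff_mem_nhds.2 fun q hq => ?_ <;>
      obtain ⟨r, hr, hb⟩ := exists_ball_eqOffThin (hF q) (hG q) <;>
      filter_upwards [Metric.ball_mem_nhds q hr] with w hw
    · exact fun hw' => hq (hb w hw hw' q (Metric.mem_ball_self hr))
    · exact hb q (Metric.mem_ball_self hr) hq w hw
  have huniv := hclopen.eq_univ ⟨p₀, fun _ => 1, analyticAt_const,
    fun h1 => one_ne_zero h1.self_of_nhds, h.mono fun z hz _ => hz⟩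
  exact Set.eq_univ_iff_forall.1 huniv p

/-! ### Meromorphy of the continuation and its behaviour at `(1 + N, -N)`. -/

theorem analyticAt_coord (i : Fin 2) (p : Fin 2 → ℂ) :
    AnalyticAt ℂ (fun z : Fin 2 → ℂ => z i) p :=
  (ContinuousLinearMap.proj (R := ℂ) (φ := fun _ : Fin 2 => ℂ) i).analyticAt p

theorem analyticAt_comp_entire {f : ℂ → ℂ} (hf : Differentiable ℂ f) {l : (Fin 2 → ℂ) → ℂ}
    {p : Fin 2 → ℂ} (hl : AnalyticAt ℂ l p) : AnalyticAt ℂ (fun z => f (l z)) p :=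
  (hf.analyticAt (l p)).comp hl

theorem analyticAt_riemannZeta {w : ℂ} (hw : w ≠ 1) : AnalyticAt ℂ riemannZeta w :=
  (differentiableOn_riemannZeta.analyticOnNhd isOpen_compl_singleton) w hw

/-- A nonzero entire function of one variable, composed with a function whose restriction to a
complex line is affine and nonconstant, is not locally zero. -/
theorem not_eventually_zero_comp {f : ℂ → ℂ} (hf : Differentiable ℂ f) {z₀ : ℂ} (hz₀ : f z₀ ≠ 0)
    {l : (Fin 2 → ℂ) → ℂ} {p v : Fin 2 → ℂ} {c : ℂ} (hc : c ≠ 0)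
    (hl : ∀ t : ℂ, l (p + t • v) = l p + t * c) : ¬ ∀ᶠ z in 𝓝 p, f (l z) = 0 := by
  intro h
  have ht : Tendsto (fun t : ℂ => p + t • v) (𝓝 0) (𝓝 p) := by
    have : Continuous fun t : ℂ => p + t • v := by fun_prop
    simpa using this.tendsto 0
  have h1 : ∀ᶠ t in 𝓝 (0 : ℂ), f (l p + t * c) = 0 := by
    filter_upwards [ht.eventually h] with t h2
    rwa [hl] at h2
  have hd : Differentiable ℂ fun t : ℂ => f (l p + t * c) := by fun_prop
  have h2 := AnalyticOnNhd.eqOn_zero_of_preconnected_of_eventuallyEq_zero (𝕜 := ℂ)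
    (fun t _ => hd.analyticAt t) isPreconnected_univ (Set.mem_univ 0) h1
  have h3 := h2 (Set.mem_univ ((z₀ - l p) / c))
  simp only [div_mul_cancel₀ _ hc, add_sub_cancel, Pi.zero_apply] at h3
  exact hz₀ h3

theorem isMeromorphicAt_doubleZeta {a b : ℕ} (ha : a ≠ 0) (hb : Even b) (hb0 : b ≠ 0)
    (p : Fin 2 → ℂ) : IsMeromorphicAt (doubleZeta a b) p := by
  have ha' : (a : ℂ) ≠ 0 := by exact_mod_cast ha
  have a0 := analyticAt_coord 0 p
  have a1 := analyticAt_coord 1 p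
  have l1 : AnalyticAt ℂ (fun s : Fin 2 → ℂ => s 1 - 1 / (b : ℂ)) p := a1.sub analyticAt_const
  have l2 : AnalyticAt ℂ (fun s : Fin 2 → ℂ => (a : ℂ) * (s 0 + s 1 - 1 / b)) p :=
    analyticAt_const.mul ((a0.add a1).sub analyticAt_const)
  have l3 : AnalyticAt ℂ (fun s : Fin 2 → ℂ => (a : ℂ) * (s 0 + s 1)) p :=
    analyticAt_const.mul (a0.add a1)
  have hΓ : Differentiable ℂ fun w : ℂ => (Complex.Gamma w)⁻¹ := Complex.differentiable_one_div_Gamma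
  have h1 := analyticAt_comp_entire hΓ l1
  have hid : Differentiable ℂ fun w : ℂ => w - 1 := by fun_prop
  have h2 := analyticAt_comp_entire hid l2
  have h3 := analyticAt_comp_entire hid l3
  have n1 : ¬ ∀ᶠ s : Fin 2 → ℂ in 𝓝 p, (Complex.Gamma (s 1 - 1 / b))⁻¹ = 0 :=
    not_eventually_zero_comp (l := fun s => s 1 - 1 / (b : ℂ)) hΓ (z₀ := 1) (by simp)
      (v := ![0, 1]) one_ne_zero (fun t => by simp; ring)
  have n2 : ¬ ∀ᶠ s : Fin 2 → ℂ in 𝓝 p, (a : ℂ) * (s 0 + s 1 - 1 / b) - 1 = 0 :=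
    not_eventually_zero_comp (l := fun s => (a : ℂ) * (s 0 + s 1 - 1 / b)) hid (z₀ := 0) (by simp)
      (v := ![0, 1]) ha' (fun t => by simp; ring)
  have n3 : ¬ ∀ᶠ s : Fin 2 → ℂ in 𝓝 p, (a : ℂ) * (s 0 + s 1) - 1 = 0 :=
    not_eventually_zero_comp (l := fun s => (a : ℂ) * (s 0 + s 1)) hid (z₀ := 0) (by simp)
      (v := ![0, 1]) ha' (fun t => by simp; ring)
  -- The denominator is the product of `1 / Γ(s₁ - 1/b)` and the two linear forms vanishing on the
  -- polar lines of the zeta factors; `riemannZeta₁` is the entire function `(w - 1) ζ(w)`.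
  refine ⟨fun s => (Complex.Gamma (s 1))⁻¹ * (Real.Gamma (1 / b + 1) *
      riemannZeta₁ (a * (s 0 + s 1 - 1 / b)) * (a * (s 0 + s 1) - 1) +
      doubleZetaRem a b s * ((Complex.Gamma (s 1 - 1 / b))⁻¹ *
      (a * (s 0 + s 1 - 1 / b) - 1) * (a * (s 0 + s 1) - 1))) -
      1 / 2 * riemannZeta₁ (a * (s 0 + s 1)) * ((Complex.Gamma (s 1 - 1 / b))⁻¹ *
      (a * (s 0 + s 1 - 1 / b) - 1)),
    fun s => (Complex.Gamma (s 1 - 1 / b))⁻¹ * (a * (s 0 + s 1 - 1 / b) - 1) *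
      (a * (s 0 + s 1) - 1), ?_, (h1.mul h2).mul h3,
    not_eventually_zero_mul (h1.mul h2) h3 (not_eventually_zero_mul h1 h2 n1 n2) n3, ?_⟩
  · exact ((analyticAt_comp_entire hΓ a1).mul (((analyticAt_const.mul
      (analyticAt_comp_entire differentiable_riemannZeta₁ l2)).mul h3).add
      ((analyticAt_doubleZetaRem ha hb hb0 p).mul ((h1.mul h2).mul h3)))).sub
      ((analyticAt_const.mul (analyticAt_comp_entire differentiable_riemannZeta₁ l3)).mul
        (h1.mul h2))
  · refine Eventually.of_forall fun s hs => ?_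
    obtain ⟨h4, h5⟩ := mul_ne_zero_iff.1 hs
    obtain ⟨h6, h7⟩ := mul_ne_zero_iff.1 h4
    rw [doubleZeta, riemannZeta_eq_inv_sub_mul (sub_ne_zero.1 h5),
      riemannZeta_eq_inv_sub_mul (sub_ne_zero.1 h7)]
    have h8 := inv_ne_zero h6
    rw [inv_inv] at h8
    beta_reduce
    generalize riemannZeta₁ _ = v
    generalize riemannZeta₁ _ = w
    generalize Complex.Gamma (s 1 - 1 / b) = g at *
    generalize (a : ℂ) * (s 0 + s 1 - 1 / b) - 1 = x at *
    generalize (a : ℂ) * (s 0 + s 1) - 1 = y at *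
    generalize (Complex.Gamma (s 1))⁻¹ = u at *
    field_simp

theorem analyticAt_doubleZeta {a b : ℕ} (ha : 2 ≤ a) (hb : Even b) (hb0 : b ≠ 0)
    (hab : 1 / (a : ℝ) + 1 / b ≠ 1) (N : ℕ) :
    AnalyticAt ℂ (doubleZeta a b) ![1 + (N : ℂ), -(N : ℂ)] := by
  have hb2 : 2 ≤ b := by
    obtain ⟨k, rfl⟩ := hb
    omega
  have a0 := analyticAt_coord 0 ![1 + (N : ℂ), -(N : ℂ)]
  have a1 := analyticAt_coord 1 ![1 + (N : ℂ), -(N : ℂ)]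
  have hΓ : Differentiable ℂ fun w : ℂ => (Complex.Gamma w)⁻¹ := Complex.differentiable_one_div_Gamma
  have g1 : AnalyticAt ℂ Complex.Gamma (-(N : ℂ) - 1 / b) := by
    have h0 : Complex.Gamma (-(N : ℂ) - 1 / b) ≠ 0 := Complex.Gamma_ne_zero fun m h => by
      have hbC : (b : ℂ) ≠ 0 := by exact_mod_cast hb0
      field_simp at h
      have h1 : (-((N : ℤ) * b) - 1 : ℤ) = -((b : ℤ) * m) := by exact_mod_cast h
      -- A pole of `Γ` at `-N - 1/b` would make `1/b` an integer, but `b ≥ 2`.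
      have h2 : (b : ℤ) ∣ 1 := ⟨m - N, by linarith⟩
      have h3 := Int.le_of_dvd one_pos h2
      omega
    simpa using (hΓ.analyticAt (-(N : ℂ) - 1 / b)).fun_inv (inv_ne_zero h0)
  have g2 : (a : ℂ) * (1 + N + -N - 1 / b) ≠ 1 := by
    intro h
    rw [add_neg_cancel_right] at h
    have h' : (a : ℝ) * (1 - 1 / b) = 1 := Complex.ofReal_injective (by push_cast; exact h)
    apply hab
    field_simp at h' ⊢
    linarith
  have g3 : (a : ℂ) * (1 + N + -N) ≠ 1 := by
    rw [add_neg_cancel_right, mul_one]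
    exact_mod_cast (by omega : a ≠ 1)
  refine ((analyticAt_comp_entire hΓ a1).mul (((analyticAt_const.mul
    (AnalyticAt.fun_comp (g := Complex.Gamma) ?_ (a1.sub analyticAt_const))).mul
    (AnalyticAt.fun_comp (g := riemannZeta) (analyticAt_riemannZeta ?_)
      (analyticAt_const.mul ((a0.add a1).sub analyticAt_const)))).add
    (analyticAt_doubleZetaRem (by omega) hb hb0 _))).sub (analyticAt_const.mul
    (AnalyticAt.fun_comp (g := riemannZeta) (analyticAt_riemannZeta ?_)
      (analyticAt_const.mul (a0.add a1))))
  · simpa using g1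
  · simpa using g2
  · simpa using g3

/-- `Complex.Gamma` takes the value `0` at `-N`, so its inverse there is `0`, which is also the true
value of the entire function `1 / Γ`. -/
theorem doubleZeta_apply_neg_nat (a b N : ℕ) :
    doubleZeta a b ![1 + (N : ℂ), -(N : ℂ)] = -(1 / 2) * riemannZeta a := by
  simp [doubleZeta, Complex.Gamma_neg_nat_eq_zero]

theorem isOpen_multiZetaDomain {n : ℕ} (d : Fin n → ℕ) : IsOpen (multiZetaDomain d) := by
  simp only [multiZetaDomain, Set.ofPred_forall]
  exact isOpen_iInter_of_finite fun j => isOpen_lt continuous_const (by fun_prop)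

theorem corollary3 (d₁ d₂ : ℕ) (hd₁ : 2 ≤ d₁) (hd₂ : 1 ≤ d₂)
    (hd : ¬ ∃ k : ℕ, (1 / (d₁ : ℝ) + 1 / (2 * (d₂ : ℝ))) = (k : ℝ)) :
    (∃ F : (Fin 2 → ℂ) → ℂ, IsMultiZetaContinuation ![d₁, 2 * d₂] ![1, 1] F) ∧
    ∀ F : (Fin 2 → ℂ) → ℂ, IsMultiZetaContinuation ![d₁, 2 * d₂] ![1, 1] F →
      ∀ N : ℕ, IsRegularPoint F ![1 + (N : ℂ), -(N : ℂ)] ∧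
        riemannZeta (d₁ : ℂ) = -2 * regularValue F ![1 + (N : ℂ), -(N : ℂ)] := by
  have ha : d₁ ≠ 0 := by omega
  have hb : Even (2 * d₂) := even_two_mul d₂
  have hb0 : 2 * d₂ ≠ 0 := by omega
  have hab : 1 / (d₁ : ℝ) + 1 / (2 * d₂ : ℕ) ≠ 1 := fun h => hd ⟨1, by push_cast at h ⊢; exact h⟩
  have hG : IsMultiZetaContinuation ![d₁, 2 * d₂] ![1, 1] (doubleZeta d₁ (2 * d₂)) :=
    ⟨isMeromorphicAt_doubleZeta ha hb hb0, fun s hs => hasSum_multiZetaTerm_two ha hb hb0 hs⟩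
  refine ⟨⟨_, hG⟩, fun F hF N => ?_⟩
  -- Any point of the open domain of convergence would do: near it both continuations equal the sum
  -- of the series.
  have hmem : ![(1 : ℂ), 1] ∈ multiZetaDomain ![d₁, 2 * d₂] := by
    have h1 : 1 / (d₁ : ℝ) ≤ 1 :=
      div_le_one_of_le₀ (by exact_mod_cast (by omega : 1 ≤ d₁)) (by positivity)
    have h2 : 1 / ((2 * d₂ : ℕ) : ℝ) < 1 :=
      (div_lt_one (by positivity)).2 (by exact_mod_cast (by omega : 1 < 2 * d₂))
    rw [mem_multiZetaDomain_two]
    simp only [Matrix.cons_val_zero, Matrix.cons_val_one, Complex.one_re]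
    exact ⟨by linarith, h2⟩
  have hEq : F =ᶠ[𝓝 ![(1 : ℂ), 1]] doubleZeta d₁ (2 * d₂) := by
    filter_upwards [(isOpen_multiZetaDomain _).mem_nhds hmem] with s hs
    exact (hF.hasSum s hs).unique (hG.hasSum s hs)
  have hthin := eqOffThin_of_eventuallyEq hF.meromorphic hG.meromorphic hEq
    ![1 + (N : ℂ), -(N : ℂ)]
  have han := analyticAt_doubleZeta hd₁ hb hb0 hab N
  refine ⟨⟨_, han, hthin⟩, ?_⟩
  rw [regularValue_eq han hthin, doubleZeta_apply_neg_nat]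
  ring
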